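/- Let $d\ge 1$ and let $G=(V,E)$ be a finite simple graph. A realization $p\in(\mathbb{R}^d)^V$ is generic if its $d|V|$ coordinates are algebraically independent over $\mathbb{Q}$. The framework $G(p)$ is locally rigid if every flexing of it (a differentiable one-parameter family of realizations of $V$ in $\mathbb{R}^d$ that contains $p$ and along which the lengths of all edges of $G$ are constant) is trivial, that is, consists of images of $p$ under Euclidean motions (isometries) of $\mathbb{R}^d$. The graph $G$ is generically redundantly rigid in $\mathbb{R}^d$ if for every generic realization $p$ the framework $G(p)$ is locally rigid and remains locally rigid after the removal of any single edge of $G$. Let $G=(V,E)$ have at least $6$ vertices, let $A_1,A_4\subseteq V$ be disjoint with $|A_1|=2$ and $|A_4|=4$, and let $A_2,A_3$ be disjoint sets of new vertices (not in $V$) with $|A_2|=3$ and $|A_3|=5$. Denote by $G\cup_{2,4}C_{2,3,5,4}$ the graph on $V\cup A_2\cup A_3$ whose edges are the edges of $G$ together with all edges between $A_1$ and $A_2$, between $A_2$ and $A_3$, and between $A_3$ and $A_4$. **Lemma.** If $G$ is generically redundantly rigid in $\mathbb{R}^5$ and has at least $6$ vertices, then, for every choice of $A_1$ and $A_4$ as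 above, $G\cup_{2,4}C_{2,3,5,4}$ is generically redundantly rigid in $\mathbb{R}^5$. -/

import Mathlib

/-! Frameworks in Euclidean space, generic redundant rigidity, `k`-chains and attachments. -/

/-- A realization assigns to every vertex a point of `ℝ^d`. -/
abbrev Realization (V : Type*) (d : ℕ) := V → EuclideanSpace ℝ (Fin d)

/-- A realization is generic if its coordinates are algebraically independent over `ℚ`. -/
def Realization.IsGeneric {V : Type*} {d : ℕ} (p : Realization V d) : Prop :=
  AlgebraicIndependent ℚ (fun c : V × Fin d => p c.1 c.2)

/-- A flexing of the framework `G(p)`: a differentiable one-parameter family of realizations that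
contains `p` and along which all edge lengths of `G` stay equal to those of `p`. -/
structure IsFlexing {V : Type*} [Fintype V] {d : ℕ} (G : SimpleGraph V) (p : Realization V d)
    (γ : ℝ → Realization V d) : Prop where
  differentiable : Differentiable ℝ γ
  start : γ 0 = p
  edge_length : ∀ t v w, G.Adj v w → dist (γ t v) (γ t w) = dist (p v) (p w)

/-- The family `γ` consists of images of `p` under Euclidean motions (isometries of `ℝ^d`). -/
def IsTrivialFamily {V : Type*} {d : ℕ} (p : Realization V d) (γ : ℝ → Realization V d) : Prop :=
  ∀ t, ∃ g : EuclideanSpace ℝ (Fin d) ≃ᵢ EuclideanSpace ℝ (Fin d), ∀ v, γ t v = g (p v)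

/-- The framework `G(p)` is locally rigid if all its flexings are trivial. -/
def IsLocallyRigid {V : Type*} [Fintype V] {d : ℕ} (G : SimpleGraph V) (p : Realization V d) :
    Prop :=
  ∀ γ : ℝ → Realization V d, IsFlexing G p γ → IsTrivialFamily p γ

/-- An edge of `G(p)` is redundant if removing it leaves a locally rigid framework. -/
def IsRedundantEdge {V : Type*} [Fintype V] {d : ℕ} (G : SimpleGraph V) (p : Realization V d)
    (e : Sym2 V) : Prop :=
  e ∈ G.edgeSet ∧ IsLocallyRigid (G.deleteEdges {e}) p

/-- The framework `G(p)` is redundantly rigid if it is locally rigid and all its edges are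
redundant. (The first clause follows from the second one as soon as `G` has an edge; it excludes
edgeless graphs.) -/
def IsRedundantlyRigid {V : Type*} [Fintype V] {d : ℕ} (G : SimpleGraph V)
    (p : Realization V d) : Prop :=
  IsLocallyRigid G p ∧ ∀ e ∈ G.edgeSet, IsRedundantEdge G p e

/-- `G` is generically redundantly rigid in `ℝ^d` if all its generic frameworks are redundantly
rigid. -/
def IsGenericallyRedundantlyRigid {V : Type*} [Fintype V] (G : SimpleGraph V) (d : ℕ) : Prop :=
  ∀ p : Realization V d, p.IsGeneric → IsRedundantlyRigid G p

/-- The `k`-chain with (pairwise disjoint) parts `A 0, …, A (k - 1)`, as a graph on an ambient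
vertex set `W`: its edges join every vertex of a part to every vertex of the next part. -/
def kChain {W : Type*} {k : ℕ} (A : Fin k → Set W) : SimpleGraph W :=
  SimpleGraph.fromRel fun x y => ∃ i j : Fin k, (i : ℕ) + 1 = j ∧ x ∈ A i ∧ y ∈ A j

/-- The four parts of the chain that is attached to a graph on `V`: the first and the last one are
the given subsets `A₁`, `A₄` of `V`, the second and the third one consist of `3` and `5` new
vertices. -/
def attachParts {V : Type*} (A₁ A₄ : Finset V) : Fin 4 → Set (V ⊕ (Fin 3 ⊕ Fin 5)) :=
  ![Sum.inl '' (A₁ : Set V),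
    Set.range fun i : Fin 3 => Sum.inr (Sum.inl i),
    Set.range fun j : Fin 5 => Sum.inr (Sum.inr j),
    Sum.inl '' (A₄ : Set V)]

/-- For disjoint `A₁`, `A₄` with `2` and `4` elements this is the graph obtained from `G` by
attaching the chain `C_{2,3,5,4}` along `A₁` and `A₄`: its edges are those of `G` and those of the
chain. -/
def attachChain {V : Type*} (G : SimpleGraph V) (A₁ A₄ : Finset V) :
    SimpleGraph (V ⊕ (Fin 3 ⊕ Fin 5)) :=
  G.map Function.Embedding.inl ⊔ kChain (attachParts A₁ A₄)

/-!
The framework on the old vertices `V` stays rigid after the removal of any one edge of `G`, and the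
eight new vertices are held by one bar more than they need. So it suffices to show two things.

* If `V` spans the space and carries a locally rigid framework, and the new vertices are
  infinitesimally rigid relative to `V`, then the whole framework is locally rigid
  (`IsLocallyRigid.of_isPinnedInfinitesimallyRigid`). Along a flexing, `V` moves by isometries;
  undoing these, the new vertices move continuously, at constant distances to fixed points and to
  each other, and such a position is isolated (`IsPinnedInfinitesimallyRigid.eventually_eq`). Only
  flexings occur here: infinitesimal rigidity of the framework on `V` is not needed.
* With `V` pinned, the `3 + 5` new vertices, which have `40` coordinates, are infinitesimally rigid
  for generic positions when any one of the `41` bars of the chain is left out. This is a system of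
  linear equations whose coefficients are polynomials in the positions, so that it is enough to
  look at one position (`IsPinnedInfinitesimallyRigid.of_isGeneric`). In the position
  `chainPosition` the velocities are computed by hand from all `41` equations
  (`eq_zero_of_chainStrain_eq_zero`), and there is a linear relation between these equations, the
  stress `chainStress`, with no coefficient equal to zero, which makes each of them a consequence
  of the other `40`.
-/

/-! ### Linear systems at generic points -/

/-- A homogeneous linear system with coefficients in `ℚ[X]` that has only the trivial solution at
one real point has only the trivial solution at every generic point: for the coefficient matrix `A`
the polynomial `det (Aᵀ * A)` does not vanish at that point, hence is not the zero polynomial. -/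
theorem AlgebraicIndependent.eq_zero_of_forall_sum_aeval_mul_eq_zero {σ ρ κ : Type*} [Fintype ρ]
    [Fintype κ] {x : σ → ℝ} (hx : AlgebraicIndependent ℚ x) (A : ρ → κ → MvPolynomial σ ℚ)
    (x₀ : σ → ℝ)
    (h₀ : ∀ z : κ → ℝ, (∀ r, ∑ k, MvPolynomial.aeval x₀ (A r k) * z k = 0) → z = 0)
    (z : κ → ℝ) (hz : ∀ r, ∑ k, MvPolynomial.aeval x (A r k) * z k = 0) : z = 0 := by
  classical
  set D : MvPolynomial σ ℚ := ((Matrix.of A).transpose * Matrix.of A).det with hD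
  let B : (σ → ℝ) → Matrix ρ κ ℝ := fun y => (Matrix.of A).map (MvPolynomial.aeval y)
  have hB : ∀ y : σ → ℝ, MvPolynomial.aeval y D = ((B y).transpose * B y).det := by
    intro y
    rw [hD, AlgHom.map_det, AlgHom.mapMatrix_apply, Matrix.map_mul, Matrix.transpose_map]
  have hker : ∀ (y : σ → ℝ) (v : κ → ℝ), ((B y).transpose * B y).mulVec v = 0 ↔
      ∀ r, ∑ k, MvPolynomial.aeval y (A r k) * v k = 0 := by
    intro y v
    have h := SetLike.ext_iff.mp (Matrix.ker_mulVecLin_transpose_mul_self (B y)) v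
    simp only [LinearMap.mem_ker, Matrix.mulVecLin_apply] at h
    rw [h, funext_iff]
    rfl
  have hD₀ : MvPolynomial.aeval x₀ D ≠ 0 := by
    rw [hB]
    intro h
    obtain ⟨v, hv, hv'⟩ := Matrix.exists_mulVec_eq_zero_iff.mpr h
    exact hv (h₀ v ((hker x₀ v).mp hv'))
  have hDx : MvPolynomial.aeval x D ≠ 0 := by
    intro h
    have hD' : D = 0 := hx (by rw [h, map_zero])
    exact hD₀ (by rw [hD', map_zero])
  by_contra hne
  rw [hB] at hDx
  exact hDx (Matrix.exists_mulVec_eq_zero_iff.mp ⟨z, hne, (hker x z).mpr hz⟩)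

theorem Realization.IsGeneric.comp {V W : Type*} {d : ℕ} {p : Realization V d} (hp : p.IsGeneric)
    {f : W → V} (hf : Function.Injective f) : Realization.IsGeneric (d := d) (p ∘ f) :=
  AlgebraicIndependent.comp hp (Prod.map f id) (hf.prodMap Function.injective_id)

/-- A generic realization of at least `d + 1` vertices spans `ℝ^d` affinely: only the zero vector
is orthogonal to all differences of its points. -/
theorem Realization.IsGeneric.eq_zero_of_forall_inner_eq_zero {V : Type*} [Fintype V] {d : ℕ}
    {p : Realization V d} (hp : p.IsGeneric) (hV : d + 1 ≤ Fintype.card V)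
    (z : EuclideanSpace ℝ (Fin d)) (hz : ∀ v w, inner ℝ z (p v - p w) = 0) : z = 0 := by
  classical
  obtain ⟨f⟩ : Nonempty (Fin (d + 1) ↪ V) :=
    Function.Embedding.nonempty_of_card_le (by simpa using hV)
  -- The comparison point places the chosen vertices at the origin and at the standard basis.
  have key := AlgebraicIndependent.eq_zero_of_forall_sum_aeval_mul_eq_zero (hp.comp f.injective)
    (fun (i : Fin d) (k : Fin d) =>
      (MvPolynomial.X (i.succ, k) - MvPolynomial.X (0, k) : MvPolynomial (Fin (d + 1) × Fin d) ℚ))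
    (fun c => if c.1 = c.2.succ then 1 else 0)
    (fun z hz => by
      ext i
      have := hz i
      simp only [map_sub, MvPolynomial.aeval_X, Fin.succ_inj, (Fin.succ_ne_zero _).symm, if_false,
        sub_zero, ite_mul, one_mul, zero_mul, Finset.sum_ite_eq, Finset.mem_univ, if_true] at this
      exact this)
    (fun k => z k)
    (fun i => by
      have := hz (f i.succ) (f 0)
      simpa [PiLp.inner_apply] using this)
  ext k
  exact congrFun key k

/-! ### Infinitesimal rigidity with pinned vertices -/

/-- The velocities (or displacements) `u` of the free vertices `N`, extended by zero to the pinned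
vertices `P`. -/
abbrev extendByZero {P N : Type*} {d : ℕ} (u : N → Fin d → ℝ) : P ⊕ N → Fin d → ℝ :=
  Sum.elim 0 u

/-- Infinitesimal rigidity of a framework with pinned vertices `P`, free vertices `N` and bars
joining the pairs `ends r`: a velocity field that vanishes on `P` and preserves the lengths of
all bars to first order is zero. -/
def IsPinnedInfinitesimallyRigid {P N ρ : Type*} {d : ℕ} (ends : ρ → (P ⊕ N) × (P ⊕ N))
    (q : P ⊕ N → Fin d → ℝ) : Prop :=
  ∀ u : N → Fin d → ℝ,
    (∀ r, ∑ k, (q (ends r).1 k - q (ends r).2 k) *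
      (extendByZero u (ends r).1 k - extendByZero u (ends r).2 k) = 0) → u = 0

theorem IsPinnedInfinitesimallyRigid.of_isGeneric {P N ρ : Type*} [Fintype N] [Fintype ρ] {d : ℕ}
    {ends : ρ → (P ⊕ N) × (P ⊕ N)} {q₀ : P ⊕ N → Fin d → ℝ}
    (h₀ : IsPinnedInfinitesimallyRigid ends q₀) {q : Realization (P ⊕ N) d} (hq : q.IsGeneric) :
    IsPinnedInfinitesimallyRigid ends fun v k => q v k := by
  classical
  let A : ρ → N × Fin d → MvPolynomial ((P ⊕ N) × Fin d) ℚ := fun r c =>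
    (MvPolynomial.X ((ends r).1, c.2) - MvPolynomial.X ((ends r).2, c.2)) *
      ((if (ends r).1 = Sum.inr c.1 then 1 else 0) - (if (ends r).2 = Sum.inr c.1 then 1 else 0))
  have hext : ∀ (u : N → Fin d → ℝ) (v : P ⊕ N) (k : Fin d),
      ∑ n, (if v = Sum.inr n then 1 else 0) * u n k =
        extendByZero u v k := by
    rintro u (v | v) k <;> simp
  have hA : ∀ (y : (P ⊕ N) × Fin d → ℝ) (u : N → Fin d → ℝ) (r : ρ),
      ∑ c : N × Fin d, MvPolynomial.aeval y (A r c) * u c.1 c.2 =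
      ∑ k, (y ((ends r).1, k) - y ((ends r).2, k)) *
        (extendByZero u (ends r).1 k - extendByZero u (ends r).2 k) := by
    intro y u r
    rw [Fintype.sum_prod_type_right]
    refine Finset.sum_congr rfl fun k _ => ?_
    rw [← hext, ← hext, ← Finset.sum_sub_distrib, Finset.mul_sum]
    refine Finset.sum_congr rfl fun n _ => ?_
    simp only [A, map_mul, map_sub, MvPolynomial.aeval_X, apply_ite (MvPolynomial.aeval y),
      map_one, map_zero]
    ring
  intro u hu
  have key := AlgebraicIndependent.eq_zero_of_forall_sum_aeval_mul_eq_zero hq A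
    (fun c => q₀ c.1 c.2)
    (fun z hz => by
      have h := h₀ (fun n k => z (n, k)) fun r => by
        rw [← hA (fun c => q₀ c.1 c.2)]
        exact hz r
      ext c
      exact congrFun (congrFun h c.1) c.2)
    (fun c => u c.1 c.2)
    (fun r => by rw [hA]; exact hu r)
  ext n k
  exact congrFun key (n, k)

/-! ### Flexings of a framework that contains a locally rigid one -/

theorem Realization.dist_sq_eq {V : Type*} {d : ℕ} (p : Realization V d) (v w : V) :
    dist (p v) (p w) ^ 2 = ∑ k, (p v k - p w k) ^ 2 := by
  rw [EuclideanSpace.dist_eq, Real.sq_sqrt (Finset.sum_nonneg fun _ _ => sq_nonneg _)]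
  simp [Real.dist_eq, sq_abs]

/-- An infinitesimally rigid pinned framework is isolated among the frameworks with the same pinned
vertices and the same bar lengths. The linear part of the length equations for the displacement is
bounded below, the remaining part is quadratic. -/
theorem IsPinnedInfinitesimallyRigid.eventually_eq {P N ρ : Type*} [Fintype N] [Fintype ρ] {d : ℕ}
    {ends : ρ → (P ⊕ N) × (P ⊕ N)} {q : P ⊕ N → Fin d → ℝ}
    (h : IsPinnedInfinitesimallyRigid ends q) :
    ∀ᶠ u : N → Fin d → ℝ in nhds 0,
      (∀ r, ∑ k, ((q + extendByZero u : P ⊕ N → Fin d → ℝ) (ends r).1 k -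
        (q + extendByZero u : P ⊕ N → Fin d → ℝ) (ends r).2 k) ^ 2 =
          ∑ k, (q (ends r).1 k - q (ends r).2 k) ^ 2) → u = 0 := by
  let ext : (N → Fin d → ℝ) →ₗ[ℝ] (P ⊕ N → Fin d → ℝ) :=
    { toFun := extendByZero
      map_add' := fun u v => by ext (x | x) k <;> simp
      map_smul' := fun c u => by ext (x | x) k <;> simp }
  let L : (N → Fin d → ℝ) →ₗ[ℝ] (ρ → ℝ) :=
    { toFun := fun u r => ∑ k, (q (ends r).1 k - q (ends r).2 k) *
        (ext u (ends r).1 k - ext u (ends r).2 k)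
      map_add' := fun u v => by
        ext r
        simp only [map_add, Pi.add_apply, ← Finset.sum_add_distrib]
        exact Finset.sum_congr rfl fun k _ => by ring
      map_smul' := fun c u => by
        ext r
        simp only [map_smul, Pi.smul_apply, smul_eq_mul, RingHom.id_apply, Finset.mul_sum]
        exact Finset.sum_congr rfl fun k _ => by ring }
  have hL : LinearMap.ker L = ⊥ :=
    LinearMap.ker_eq_bot'.mpr fun u hu => h u fun r => congrFun hu r
  obtain ⟨K, hK, hanti⟩ := L.exists_antilipschitzWith hL
  have hext : ∀ u x k, |ext u x k| ≤ ‖u‖ := by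
    rintro u (x | x) k
    · simp [ext]
    · exact (norm_le_pi_norm (u x) k).trans (norm_le_pi_norm u x)
  have hsq : ∀ u : N → Fin d → ℝ,
      (∀ r, ∑ k, ((q + ext u) (ends r).1 k - (q + ext u) (ends r).2 k) ^ 2 =
        ∑ k, (q (ends r).1 k - q (ends r).2 k) ^ 2) → ‖L u‖ ≤ 2 * d * ‖u‖ ^ 2 := by
    intro u hu
    refine (pi_norm_le_iff_of_nonneg (by positivity)).mpr fun r => ?_
    have h₁ : 2 * L u r = -∑ k, (ext u (ends r).1 k - ext u (ends r).2 k) ^ 2 := by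
      have h₂ : ∑ k, ((q + ext u) (ends r).1 k - (q + ext u) (ends r).2 k) ^ 2 =
          ∑ k, (q (ends r).1 k - q (ends r).2 k) ^ 2 + 2 * L u r +
            ∑ k, (ext u (ends r).1 k - ext u (ends r).2 k) ^ 2 := by
        simp only [L, LinearMap.coe_mk, AddHom.coe_mk, Finset.mul_sum, ← Finset.sum_add_distrib,
          Pi.add_apply]
        exact Finset.sum_congr rfl fun k _ => by ring
      linarith [hu r]
    have h₃ : ∑ k, (ext u (ends r).1 k - ext u (ends r).2 k) ^ 2 ≤
        ∑ _k : Fin d, 4 * ‖u‖ ^ 2 := by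
      refine Finset.sum_le_sum fun k _ => ?_
      have h₄ : |ext u (ends r).1 k - ext u (ends r).2 k| ≤ 2 * ‖u‖ :=
        (abs_sub _ _).trans (by linarith [hext u (ends r).1 k, hext u (ends r).2 k])
      calc _ ≤ (2 * ‖u‖) ^ 2 := sq_le_sq' (abs_le.mp h₄).1 (abs_le.mp h₄).2
        _ = 4 * ‖u‖ ^ 2 := by ring
    have h₅ : 0 ≤ ∑ k, (ext u (ends r).1 k - ext u (ends r).2 k) ^ 2 :=
      Finset.sum_nonneg fun _ _ => sq_nonneg _
    rw [Finset.sum_const, Finset.card_univ, Fintype.card_fin, nsmul_eq_mul] at h₃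
    rw [Real.norm_eq_abs, abs_le]
    constructor <;> linarith
  have hnear : ∀ᶠ u : N → Fin d → ℝ in nhds 0, K * (2 * d * ‖u‖) < 1 := by
    have hcont : Continuous fun u : N → Fin d → ℝ => K * (2 * d * ‖u‖) := by fun_prop
    exact hcont.continuousAt.eventually_lt continuousAt_const (by simp)
  filter_upwards [hnear] with u hu₁ hu₂
  by_contra hne
  have hpos : 0 < ‖u‖ := norm_pos_iff.mpr hne
  have h₁ : ‖u‖ ≤ K * ‖L u‖ := by
    simpa using hanti.le_mul_dist u 0
  have h₂ : ‖u‖ ≤ K * (2 * d * ‖u‖) * ‖u‖ := by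
    calc ‖u‖ ≤ K * ‖L u‖ := h₁
      _ ≤ K * (2 * d * ‖u‖ ^ 2) := by gcongr; exact hsq u hu₂
      _ = _ := by ring
  nlinarith

/-- A point of `ℝ^d` depends continuously on a parameter as soon as its distances to the points
of an affinely spanning family do. -/
theorem continuous_of_continuous_dist {T V : Type*} [TopologicalSpace T] [Fintype V] {d : ℕ}
    {p : Realization V d}
    (hp : ∀ z : EuclideanSpace ℝ (Fin d), (∀ v w, inner ℝ z (p v - p w) = 0) → z = 0)
    {x : T → EuclideanSpace ℝ (Fin d)} (hx : ∀ v, Continuous fun t => dist (x t) (p v)) :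
    Continuous x := by
  let L : EuclideanSpace ℝ (Fin d) →ₗ[ℝ] (V → V → ℝ) :=
    { toFun := fun z v w => inner ℝ z (p v - p w)
      map_add' := fun y z => by ext v w; simp [inner_add_left]
      map_smul' := fun c z => by ext v w; simp [inner_smul_left] }
  obtain ⟨M, hM⟩ := L.exists_leftInverse_of_injective
    (LinearMap.ker_eq_bot'.mpr fun z hz => hp z fun v w => congrFun (congrFun hz v) w)
  have hLx : Continuous fun t => L (x t) := by
    refine continuous_pi fun v => continuous_pi fun w => ?_
    -- The difference of two squared distances is affine in the point.
    have h : ∀ t, L (x t) v w =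
        (dist (x t) (p w) ^ 2 - dist (x t) (p v) ^ 2 + ‖p v‖ ^ 2 - ‖p w‖ ^ 2) / 2 := by
      intro t
      change inner ℝ (x t) (p v - p w) = _
      rw [dist_eq_norm, dist_eq_norm, norm_sub_sq_real, norm_sub_sq_real, inner_sub_right]
      ring
    simp only [h]
    have h₁ := hx v
    have h₂ := hx w
    fun_prop
  have hMx : x = fun t => M (L (x t)) := by
    ext1 t
    exact (LinearMap.congr_fun hM (x t)).symm
  rw [hMx]
  exact M.continuous_of_finiteDimensional.comp hLx

/-- If the part of a framework on the vertices `V` is locally rigid and affinely spanning, and the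
bars `ends` make the remaining vertices infinitesimally rigid relative to `V`, then the whole
framework is locally rigid. In a frame that moves along with `V`, the remaining vertices move
continuously and are isolated. -/
theorem IsLocallyRigid.of_isPinnedInfinitesimallyRigid {V N ρ : Type*} [Fintype V] [Fintype N]
    [Fintype ρ] {d : ℕ} {H : SimpleGraph (V ⊕ N)} {G : SimpleGraph V} {q : Realization (V ⊕ N) d}
    (hG : IsLocallyRigid G fun v => q (.inl v))
    (hspan : ∀ z : EuclideanSpace ℝ (Fin d),
      (∀ v w, inner ℝ z (q (.inl v) - q (.inl w)) = 0) → z = 0)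
    (hGH : ∀ v w, G.Adj v w → H.Adj (.inl v) (.inl w)) {ends : ρ → (V ⊕ N) × (V ⊕ N)}
    (hends : ∀ r, H.Adj (ends r).1 (ends r).2)
    (hpin : IsPinnedInfinitesimallyRigid ends fun v k => q v k) : IsLocallyRigid H q := by
  intro γ hγ
  have hdiff : ∀ x, Differentiable ℝ fun t => γ t x := differentiable_pi.mp hγ.differentiable
  have hV := hG (fun t v => γ t (.inl v))
    ⟨differentiable_pi.mpr fun v => hdiff _, by rw [hγ.start],
      fun t v w hvw => hγ.edge_length t _ _ (hGH v w hvw)⟩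
  -- The isometry at time `0` is taken to be the identity on all of `ℝ^d`, not only on `V`.
  have hV' : ∀ t, ∃ g : EuclideanSpace ℝ (Fin d) ≃ᵢ EuclideanSpace ℝ (Fin d),
      (∀ v, γ t (.inl v) = g (q (.inl v))) ∧ (t = 0 → g = IsometryEquiv.refl _) := by
    intro t
    rcases eq_or_ne t 0 with rfl | ht
    · exact ⟨IsometryEquiv.refl _, fun v => by rw [hγ.start]; rfl, fun _ => rfl⟩
    · obtain ⟨g, hg⟩ := hV t
      exact ⟨g, hg, fun h => absurd h ht⟩
  choose g hg hg₀ using hV'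
  let δ : ℝ → Realization (V ⊕ N) d := fun t x => (g t).symm (γ t x)
  have hδV : ∀ t v, δ t (.inl v) = q (.inl v) := fun t v => by
    simp only [δ, hg, IsometryEquiv.symm_apply_apply]
  have hδdist : ∀ t x y, dist (δ t x) (δ t y) = dist (γ t x) (γ t y) := fun t x y =>
    (g t).symm.dist_eq _ _
  have hδcont : ∀ x, Continuous fun t => δ t x := fun x => by
    refine continuous_of_continuous_dist hspan fun v => ?_
    have h : ∀ t, dist (δ t x) (q (.inl v)) = dist (γ t x) (γ t (.inl v)) := fun t => by
      rw [← hδV t v, hδdist]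
    simp only [h]
    exact (hdiff _).continuous.dist (hdiff _).continuous
  let u : ℝ → N → Fin d → ℝ := fun t n k => δ t (.inr n) k - q (.inr n) k
  have hu : Continuous u := by
    refine continuous_pi fun n => continuous_pi fun k => Continuous.sub ?_ continuous_const
    have := hδcont (.inr n)
    fun_prop
  have hδu : ∀ t x k, δ t x k =
      ((fun v k => q v k) + extendByZero (u t) : V ⊕ N → Fin d → ℝ) x k := by
    rintro t (v | n) k
    · simp [hδV]
    · simp [u]
  have hlen : ∀ t r,
      ∑ k, (δ t (ends r).1 k - δ t (ends r).2 k) ^ 2 =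
        ∑ k, (q (ends r).1 k - q (ends r).2 k) ^ 2 := fun t r => by
    rw [← Realization.dist_sq_eq, ← Realization.dist_sq_eq, hδdist,
      hγ.edge_length t _ _ (hends r)]
  have hclopen : IsClopen {t | u t = 0} := by
    refine ⟨isClosed_eq hu continuous_const, isOpen_iff_mem_nhds.mpr fun t ht => ?_⟩
    have hnear := hu.tendsto t
    rw [show u t = 0 from ht] at hnear
    filter_upwards [hnear.eventually hpin.eventually_eq] with s hs
    refine hs fun r => ?_
    simp only [← hδu]
    exact hlen s r
  have hzero : u 0 = 0 := by
    ext n k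
    simp only [u, δ, hg₀ 0 rfl, hγ.start]
    exact sub_self _
  have huniv := hclopen.eq_univ ⟨0, hzero⟩
  intro t
  refine ⟨g t, fun x => ?_⟩
  have ht : u t = 0 := by
    have : t ∈ {t | u t = 0} := huniv ▸ Set.mem_univ t
    exact this
  have hx : δ t x = q x := by
    ext k
    rw [hδu, ht]
    rcases x with v | n <;> simp
  rw [← hx]
  exact ((g t).apply_symm_apply _).symm

/-! ### The pinned chain -/

/-- The bars of the chain `C_{2,3,5,4}`: between its first two, its middle two and its last two
parts. -/
abbrev ChainBar := (Fin 3 × Fin 2) ⊕ (Fin 3 × Fin 5) ⊕ (Fin 5 × Fin 4)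

/-- The ends of the bars of the chain; its first and its last part are the pinned vertices. -/
def chainEnds : ChainBar →
    ((Fin 2 ⊕ Fin 4) ⊕ (Fin 3 ⊕ Fin 5)) × ((Fin 2 ⊕ Fin 4) ⊕ (Fin 3 ⊕ Fin 5))
  | .inl (i, k) => (.inr (.inl i), .inl (.inl k))
  | .inr (.inl (i, j)) => (.inr (.inl i), .inr (.inr j))
  | .inr (.inr (j, l)) => (.inr (.inr j), .inl (.inr l))

/-- A special position of the chain. The four pinned points of the last part span a coordinate
3-space, so each of their neighbours moves with one degree of freedom, by a rotation in the
plane of the last two coordinates. -/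
def chainPosition : (Fin 2 ⊕ Fin 4) ⊕ (Fin 3 ⊕ Fin 5) → Fin 5 → ℝ :=
  Sum.elim
    (Sum.elim ![![0, 0, 0, 1, 0], ![0, 0, 0, 1, 1]]
      ![![0, 0, 0, 0, 0], ![1, 0, 0, 0, 0], ![0, 1, 0, 0, 0], ![0, 0, 1, 0, 0]])
    (Sum.elim ![![1, 0, 0, 1, 0], ![0, 1, 0, 1, 1], ![0, 0, 2, 1, 2]]
      ![![1, 0, 0, 1, 1], ![0, 1, 0, 1, 0], ![0, 0, 1, 1, 0], ![0, 0, 0, 2, 0], ![1, 1, 1, 2, 2]])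

/-- The equilibrium stress, unique up to scaling, of the chain in the position `chainPosition`. -/
def chainStress : ChainBar → ℝ
  | .inl (i, k) => ![1, -2, 1] i * ![-4, 1] k
  | .inr (.inl (i, j)) => ![1, -2, 1] i * ![1, 1, 1, 1, -1] j
  | .inr (.inr (j, l)) => ![1, 1, 1, 1, -1] j * ![1, -1, 2, -2] l

theorem chainStress_ne_zero (r : ChainBar) : chainStress r ≠ 0 := by
  rcases r with ⟨i, k⟩ | ⟨i, j⟩ | ⟨j, l⟩ <;> refine mul_ne_zero ?_ ?_
  · fin_cases i <;> simp
  · fin_cases k <;> simp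
  · fin_cases i <;> simp
  · fin_cases j <;> simp
  · fin_cases j <;> simp
  · fin_cases l <;> simp

/-- The first order change of the squared length (up to a factor `2`) of a bar of the chain in the
position `chainPosition` under the velocities `u` of the free vertices. -/
def chainStrain (u : Fin 3 ⊕ Fin 5 → Fin 5 → ℝ) (r : ChainBar) : ℝ :=
  ∑ k, (chainPosition (chainEnds r).1 k - chainPosition (chainEnds r).2 k) *
    (extendByZero u (chainEnds r).1 k - extendByZero u (chainEnds r).2 k)

/-- The stress is in equilibrium at the free vertices, in the dual formulation. -/
theorem sum_chainStress_mul_chainStrain (u : Fin 3 ⊕ Fin 5 → Fin 5 → ℝ) :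
    ∑ r, chainStress r * chainStrain u r = 0 := by
  simp only [Fintype.sum_sum_type, Fintype.sum_prod_type, chainStrain, chainEnds, chainStress,
    chainPosition, Sum.elim_inl, Sum.elim_inr, Pi.zero_apply]
  simp [Fin.sum_univ_succ]
  ring

theorem eq_zero_of_chainStrain_eq_zero (u : Fin 3 ⊕ Fin 5 → Fin 5 → ℝ)
    (hu : ∀ r, chainStrain u r = 0) : u = 0 := by
  have h₁ : ∀ i k, chainStrain u (.inl (i, k)) = 0 := fun i k => hu _
  have h₂ : ∀ i j, chainStrain u (.inr (.inl (i, j))) = 0 := fun i j => hu _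
  have h₃ : ∀ j l, chainStrain u (.inr (.inr (j, l))) = 0 := fun j l => hu _
  simp only [chainStrain, chainEnds, chainPosition, Sum.elim_inl, Sum.elim_inr, Pi.zero_apply,
    Fin.sum_univ_five, Fin.forall_fin_succ] at h₁ h₂ h₃
  simp at h₁ h₂ h₃
  obtain ⟨⟨a₁, a₂⟩, ⟨a₃, a₄⟩, a₅, a₆⟩ := h₁
  obtain ⟨⟨b₁, b₂, b₃, b₄, b₅⟩, ⟨b₆, b₇, b₈, b₉, b₁₀⟩, b₁₁, b₁₂, b₁₃, b₁₄, _⟩ := h₂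
  obtain ⟨⟨c₁, c₂, c₃, c₄⟩, ⟨c₅, c₆, c₇, c₈⟩, ⟨c₉, c₁₀, c₁₁, c₁₂⟩, ⟨c₁₃, c₁₄, c₁₅, c₁₆⟩,
    c₁₇, c₁₈, c₁₉, c₂₀⟩ := h₃
  -- The bars between the last two parts leave only the last two coordinates of `u (.inr j)`.
  have x₀₀ : u (.inr 0) 0 = 0 := by linarith only [c₁, c₂]
  have x₀₁ : u (.inr 0) 1 = 0 := by linarith only [c₁, c₃]
  have x₀₂ : u (.inr 0) 2 = 0 := by linarith only [c₁, c₄]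
  have x₁₀ : u (.inr 1) 0 = 0 := by linarith only [c₅, c₆]
  have x₁₁ : u (.inr 1) 1 = 0 := by linarith only [c₅, c₇]
  have x₁₂ : u (.inr 1) 2 = 0 := by linarith only [c₅, c₈]
  have x₂₀ : u (.inr 2) 0 = 0 := by linarith only [c₉, c₁₀]
  have x₂₁ : u (.inr 2) 1 = 0 := by linarith only [c₉, c₁₁]
  have x₂₂ : u (.inr 2) 2 = 0 := by linarith only [c₉, c₁₂]
  have x₃₀ : u (.inr 3) 0 = 0 := by linarith only [c₁₃, c₁₄]
  have x₃₁ : u (.inr 3) 1 = 0 := by linarith only [c₁₃, c₁₅]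
  have x₃₂ : u (.inr 3) 2 = 0 := by linarith only [c₁₃, c₁₆]
  have x₄₀ : u (.inr 4) 0 = 0 := by linarith only [c₁₇, c₁₈]
  have x₄₁ : u (.inr 4) 1 = 0 := by linarith only [c₁₇, c₁₉]
  have x₄₂ : u (.inr 4) 2 = 0 := by linarith only [c₁₇, c₂₀]
  -- The two bars to the first part kill two coordinates of each `u (.inl i)`.
  have y₀₀ : u (.inl 0) 0 = 0 := a₁
  have y₀₄ : u (.inl 0) 4 = 0 := by linarith only [a₁, a₂]
  have y₁₁ : u (.inl 1) 1 = 0 := a₄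
  have y₁₄ : u (.inl 1) 4 = 0 := by linarith only [a₃, a₄]
  have y₂₂ : u (.inl 2) 2 = 0 := by linarith only [a₅, a₆]
  have y₂₄ : u (.inl 2) 4 = 0 := by linarith only [a₅, a₆]
  simp only [x₀₀, x₀₁, x₀₂, x₁₀, x₁₁, x₁₂, x₂₀, x₂₁, x₂₂, x₃₀, x₃₁, x₃₂, x₄₀, x₄₁, x₄₂, y₀₀, y₀₄,
    y₁₁, y₁₄, y₂₂, y₂₄]
    at b₁ b₂ b₃ b₄ b₅ b₆ b₇ b₈ b₉ b₁₀ b₁₁ b₁₂ b₁₃ b₁₄ c₂ c₅ c₉ c₁₇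
  -- The remaining unknowns follow one by one from the bars between the middle parts.
  have x₁₃ : u (.inr 1) 3 = 0 := by linarith only [c₅]
  have x₂₃ : u (.inr 2) 3 = 0 := by linarith only [c₉]
  have x₃₃ : u (.inr 3) 3 = 0 := by linarith only [c₁₃]
  have x₀₄ : u (.inr 0) 4 = 0 := by linarith only [b₁]
  have x₀₃ : u (.inr 0) 3 = 0 := by linarith only [c₂, x₀₄]
  have x₁₄ : u (.inr 1) 4 = 0 := by linarith only [b₇]
  have x₂₄ : u (.inr 2) 4 = 0 := by linarith only [b₁₃]
  have y₀₁ : u (.inl 0) 1 = 0 := by linarith only [b₂]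
  have y₀₂ : u (.inl 0) 2 = 0 := by linarith only [b₃]
  have y₀₃ : u (.inl 0) 3 = 0 := by linarith only [b₄, x₃₃]
  have x₄₄ : u (.inr 4) 4 = 0 := by linarith only [b₅, c₁₇, y₀₁, y₀₂, y₀₃]
  have x₄₃ : u (.inr 4) 3 = 0 := by linarith only [c₁₇, x₄₄]
  have y₁₀ : u (.inl 1) 0 = 0 := by linarith only [b₆]
  have y₁₂ : u (.inl 1) 2 = 0 := by linarith only [b₈, x₂₄]
  have y₁₃ : u (.inl 1) 3 = 0 := by linarith only [b₁₀, y₁₀, y₁₂, x₄₃, x₄₄]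
  have x₃₄ : u (.inr 3) 4 = 0 := by linarith only [b₉, y₁₃, x₃₃]
  have y₂₀ : u (.inl 2) 0 = 0 := by linarith only [b₁₁, x₀₄]
  have y₂₁ : u (.inl 2) 1 = 0 := by linarith only [b₁₂, x₁₄]
  have y₂₃ : u (.inl 2) 3 = 0 := by linarith only [b₁₄, x₃₃, x₃₄]
  ext n k
  rcases n with i | j
  · fin_cases i <;> fin_cases k <;> assumption
  · fin_cases j <;> fin_cases k <;> assumption

/-- In the position `chainPosition` every single bar may be left out: the bars carry a nowhere
vanishing stress, so the strain of each of them is determined by the other ones. -/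
theorem isPinnedInfinitesimallyRigid_chainPosition (r₀ : ChainBar) :
    IsPinnedInfinitesimallyRigid (fun r : {r // r ≠ r₀} => chainEnds r) chainPosition := by
  intro u hu
  have hu' : ∀ r, r ≠ r₀ → chainStrain u r = 0 := fun r hr => hu ⟨r, hr⟩
  refine eq_zero_of_chainStrain_eq_zero u fun r => ?_
  by_cases hr : r = r₀
  · have h := sum_chainStress_mul_chainStrain u
    rw [Finset.sum_eq_single r₀ (fun r _ hr => by rw [hu' r hr, mul_zero]) (by simp)] at h
    rw [hr]
    exact (mul_eq_zero.mp h).resolve_left (chainStress_ne_zero r₀)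
  · exact hu' r hr

/-! ### Attaching the chain -/

theorem IsPinnedInfinitesimallyRigid.map {P Q N ρ : Type*} {d : ℕ} {ends : ρ → (P ⊕ N) × (P ⊕ N)}
    {f : P → Q} {q : Q ⊕ N → Fin d → ℝ}
    (h : IsPinnedInfinitesimallyRigid ends (q ∘ Sum.map f id)) :
    IsPinnedInfinitesimallyRigid
      (fun r => ((ends r).1.map f id, (ends r).2.map f id)) q := by
  have hext : ∀ (u : N → Fin d → ℝ) (x : P ⊕ N),
      extendByZero u (x.map f id) = extendByZero u x := by
    rintro u (x | x) <;> rfl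
  intro u hu
  refine h u fun r => ?_
  have hr := hu r
  simp only [hext] at hr
  exact hr

/-- The edge of the graph with an attached chain that a bar of the chain stands for, where `f` lists
the vertices to which the chain is attached. -/
def chainEdge {V : Type*} (f : Fin 2 ⊕ Fin 4 → V) (r : ChainBar) :
    Sym2 (V ⊕ (Fin 3 ⊕ Fin 5)) :=
  s((chainEnds r).1.map f id, (chainEnds r).2.map f id)

theorem chainEdge_injective {V : Type*} {f : Fin 2 ⊕ Fin 4 → V} (hf : Function.Injective f) :
    Function.Injective (chainEdge f) := by
  intro r r' h
  have h' : s((chainEnds r).1, (chainEnds r).2) = s((chainEnds r').1, (chainEnds r').2) :=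
    Sym2.map.injective (hf.sumMap Function.injective_id) h
  rcases r with ⟨i, k⟩ | ⟨i, j⟩ | ⟨j, l⟩ <;> rcases r' with ⟨i', k'⟩ | ⟨i', j'⟩ | ⟨j', l'⟩ <;>
    simp_all [chainEnds]

theorem chainEdge_ne {V : Type*} (f : Fin 2 ⊕ Fin 4 → V) (r : ChainBar) (v w : V) :
    chainEdge f r ≠ s(.inl v, .inl w) := by
  rcases r with ⟨i, k⟩ | ⟨i, j⟩ | ⟨j, l⟩ <;> simp [chainEdge, chainEnds]

theorem chainEdge_mem_edgeSet_attachChain {V : Type*} (G : SimpleGraph V) {A₁ A₄ : Finset V}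
    {f : Fin 2 ⊕ Fin 4 → V} (hf₁ : ∀ k, f (.inl k) ∈ A₁) (hf₄ : ∀ l, f (.inr l) ∈ A₄)
    (r : ChainBar) : chainEdge f r ∈ (attachChain G A₁ A₄).edgeSet := by
  rw [chainEdge, SimpleGraph.mem_edgeSet, attachChain, SimpleGraph.sup_adj]
  refine Or.inr ?_
  rw [kChain, SimpleGraph.fromRel_adj]
  rcases r with ⟨i, k⟩ | ⟨i, j⟩ | ⟨j, l⟩
  · refine ⟨by simp [chainEnds], Or.inr ⟨0, 1, rfl, ?_, ?_⟩⟩ <;>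
      simp [chainEnds, attachParts, hf₁]
  · refine ⟨by simp [chainEnds], Or.inl ⟨1, 2, rfl, ?_, ?_⟩⟩ <;> simp [chainEnds, attachParts]
  · refine ⟨by simp [chainEnds], Or.inl ⟨2, 3, rfl, ?_, ?_⟩⟩ <;>
      simp [chainEnds, attachParts, hf₄]

/-- Attaching all bars of the chain but one to a locally rigid graph gives a generically locally
rigid graph. -/
theorem IsLocallyRigid.of_chainEdge_mem_edgeSet {V : Type*} [Fintype V] {G : SimpleGraph V}
    (hV : 6 ≤ Fintype.card V) {f : Fin 2 ⊕ Fin 4 → V} (hf : Function.Injective f)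
    {H : SimpleGraph (V ⊕ (Fin 3 ⊕ Fin 5))} {q : Realization (V ⊕ (Fin 3 ⊕ Fin 5)) 5}
    (hq : q.IsGeneric) (hG : IsLocallyRigid G (q ∘ Sum.inl))
    (hGH : ∀ v w, G.Adj v w → H.Adj (.inl v) (.inl w)) (r₀ : ChainBar)
    (hH : ∀ r, r ≠ r₀ → chainEdge f r ∈ H.edgeSet) : IsLocallyRigid H q := by
  have hpin := IsPinnedInfinitesimallyRigid.map (f := f) (q := fun v k => q v k)
    ((isPinnedInfinitesimallyRigid_chainPosition r₀).of_isGeneric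
      (hq.comp (hf.sumMap Function.injective_id)))
  refine IsLocallyRigid.of_isPinnedInfinitesimallyRigid hG
    ((hq.comp Sum.inl_injective).eq_zero_of_forall_inner_eq_zero hV) hGH (fun r => ?_) hpin
  exact hH r.1 r.2

theorem lemma5p4 {V : Type*} [Fintype V] (G : SimpleGraph V) (hV : 6 ≤ Fintype.card V)
    (hG : IsGenericallyRedundantlyRigid G 5) (A₁ A₄ : Finset V) (hA₁ : A₁.card = 2)
    (hA₄ : A₄.card = 4) (hdisj : Disjoint A₁ A₄) :
    IsGenericallyRedundantlyRigid (attachChain G A₁ A₄) 5 := by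
  intro q hq
  obtain ⟨hrig, hred⟩ := hG _ (hq.comp Sum.inl_injective)
  let e₁ := (A₁.equivFinOfCardEq hA₁).symm
  let e₄ := (A₄.equivFinOfCardEq hA₄).symm
  let f : Fin 2 ⊕ Fin 4 → V := Sum.elim (fun k => e₁ k) (fun l => e₄ l)
  have hf₁ : ∀ k, f (.inl k) ∈ A₁ := fun k => (e₁ k).2
  have hf₄ : ∀ l, f (.inr l) ∈ A₄ := fun l => (e₄ l).2
  have hf : Function.Injective f :=
    (Subtype.val_injective.comp e₁.injective).sumElim (Subtype.val_injective.comp e₄.injective)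
      fun k l => Finset.disjoint_iff_ne.mp hdisj _ (hf₁ k) _ (hf₄ l)
  have hmem := chainEdge_mem_edgeSet_attachChain G hf₁ hf₄
  have hadj : ∀ v w, G.Adj v w → (attachChain G A₁ A₄).Adj (.inl v) (.inl w) := fun v w h =>
    Or.inl (SimpleGraph.map_adj_apply.mpr h)
  refine ⟨.of_chainEdge_mem_edgeSet hV hf hq hrig hadj (.inl (0, 0)) fun r _ => hmem r,
    fun e he => ⟨he, ?_⟩⟩
  have hmem' : ∀ r, chainEdge f r ≠ e →
      chainEdge f r ∈ ((attachChain G A₁ A₄).deleteEdges {e}).edgeSet := fun r hr => by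
    rw [SimpleGraph.edgeSet_deleteEdges]
    exact ⟨hmem r, hr⟩
  -- An edge of `G` is left out of the rigid graph on `V`, an edge of the chain from its bars.
  by_cases h : ∃ v w, G.Adj v w ∧ e = s(.inl v, .inl w)
  · obtain ⟨v, w, hvw, rfl⟩ := h
    refine .of_chainEdge_mem_edgeSet hV hf hq (hred s(v, w) hvw).2 (fun v' w' h => ?_) (.inl (0, 0))
      fun r _ => hmem' r (chainEdge_ne f r v w)
    rw [SimpleGraph.deleteEdges_adj] at h ⊢
    exact ⟨hadj _ _ h.1, fun h' => h.2 (Sym2.map.injective Sum.inl_injective h')⟩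
  · have hadj' : ∀ v w, G.Adj v w →
        ((attachChain G A₁ A₄).deleteEdges {e}).Adj (.inl v) (.inl w) := fun v w hvw => by
      rw [SimpleGraph.deleteEdges_adj]
      exact ⟨hadj v w hvw, fun h' => h ⟨v, w, hvw, h'.symm⟩⟩
    by_cases hr : ∃ r₀, chainEdge f r₀ = e
    · obtain ⟨r₀, hr₀⟩ := hr
      exact .of_chainEdge_mem_edgeSet hV hf hq hrig hadj' r₀ fun r hr =>
        hmem' r (hr₀ ▸ (chainEdge_injective hf).ne hr)
    · exact .of_chainEdge_mem_edgeSet hV hf hq hrig hadj' (.inl (0, 0)) fun r _ =>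
        hmem' r fun h => hr ⟨r, h⟩
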